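/- Let $0<\lambda<\Lambda$ and $\tilde N_-=\frac{\Lambda}{\lambda}+1$ (the dimension-like number $\frac{\Lambda}{\lambda}(N-1)+1$ in dimension $N=2$), so that $\tilde N_->2$. For $p>1$ consider in the open first quadrant $\{X>0,\ Z>0\}$ the planar autonomous system $$\dot X=\begin{cases}X\left(X+\frac{Z}{\Lambda}\right) & \text{if } Z>\Lambda,\\ X\left(X-(\tilde N_--2)+\frac{Z}{\lambda}\right) & \text{if } 0<Z\le\Lambda,\end{cases}\qquad \dot Z=\begin{cases}Z\left(2-pX-\frac{Z}{\Lambda}\right) & \text{if } Z>\Lambda,\\ Z\left(\tilde N_--pX-\frac{Z}{\lambda}\right) & \text{if } 0<Z\le\Lambda,\end{cases}$$ whose right-hand side is continuous (on the line $Z=\Lambda$ the two formulas agree). A periodic orbit is a nonconstant solution $(X,Z)$ defined on $\mathbb R$, with values in the open first quadrant, that is periodic with some period $T>0$. Let $$\tilde p_-=\inf\left\{p\in\left(\tfrac{\tilde N_-+2}{\tilde N_--2},\infty\right)\ :\ \text{for every } p'>p \text{ the system with exponent } p' \text{ has no periodic orbit}\right\}.$$ Then this set is nonempty and $$\frac{\tilde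 N_-+2}{\tilde N_--2}\ \le\ \tilde p_-\ \le\ \frac{\tilde N_-+2}{\tilde N_--2}+\frac{4}{\tilde N_--2+\frac{\lambda}{\Lambda}(\tilde N_--2)^2}.$$ -/

import Mathlib

/-- The dimension-like number `Ñ₋ = (Λ/λ)(N - 1) + 1` of the Pucci operator `𝓜⁻` in dimension `N`.
(`lam` stands for `λ`, `Lam` for `Λ`.) -/
noncomputable def dimMinus (lam Lam : ℝ) (N : ℕ) : ℝ :=
  Lam / lam * ((N : ℝ) - 1) + 1

/-- First component of the planar vector field (dimension `N = 2`). The two formulas agree on the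
line `Z = Λ` (see `fieldX_eq_on_line`), so the choice made there is immaterial. -/
noncomputable def fieldX (lam Lam X Z : ℝ) : ℝ :=
  if Lam < Z then X * (X + Z / Lam)
  else X * (X - (dimMinus lam Lam 2 - 2) + Z / lam)

/-- Second component of the planar vector field (dimension `N = 2`, exponent `p`). The two formulas
agree on the line `Z = Λ` (see `fieldZ_eq_on_line`). -/
noncomputable def fieldZ (lam Lam p X Z : ℝ) : ℝ :=
  if Lam < Z then Z * (2 - p * X - Z / Lam)
  else Z * (dimMinus lam Lam 2 - p * X - Z / lam)

theorem fieldX_eq_on_line {lam Lam : ℝ} (hLam : Lam ≠ 0) (X : ℝ) :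
    X * (X + Lam / Lam) = X * (X - (dimMinus lam Lam 2 - 2) + Lam / lam) := by
  rw [div_self hLam, dimMinus]; push_cast; ring

theorem fieldZ_eq_on_line {lam Lam : ℝ} (hLam : Lam ≠ 0) (p X : ℝ) :
    Lam * (2 - p * X - Lam / Lam) = Lam * (dimMinus lam Lam 2 - p * X - Lam / lam) := by
  rw [div_self hLam, dimMinus]; push_cast; ring

/-- The system `(Ẋ, Ż) = F(X, Z)` with exponent `p` has a periodic orbit in the open first quadrant,
i.e. a nonconstant solution defined on the whole line, with values in that quadrant, which is
periodic with some period `T > 0`. -/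
def HasPeriodicOrbit (lam Lam p : ℝ) : Prop :=
  ∃ (X Z : ℝ → ℝ) (T : ℝ), 0 < T ∧
    (∀ t, 0 < X t ∧ 0 < Z t) ∧
    (∀ t, HasDerivAt X (fieldX lam Lam (X t) (Z t)) t) ∧
    (∀ t, HasDerivAt Z (fieldZ lam Lam p (X t) (Z t)) t) ∧
    (∀ t, X (t + T) = X t ∧ Z (t + T) = Z t) ∧
    (∃ s t, X s ≠ X t ∨ Z s ≠ Z t)

/-- The exponents `p > (Ñ₋ + 2)/(Ñ₋ - 2)` such that there is no periodic orbit for any larger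
exponent `p' > p`. -/
def noOrbitExponents (lam Lam : ℝ) : Set ℝ :=
  {p | (dimMinus lam Lam 2 + 2) / (dimMinus lam Lam 2 - 2) < p ∧
    ∀ p', p < p' → ¬ HasPeriodicOrbit lam Lam p'}

/-- The exponent `p̃₋`, the infimum of `noOrbitExponents`. -/
noncomputable def pTildeMinus (lam Lam : ℝ) : ℝ :=
  sInf (noOrbitExponents lam Lam)

open Set Filter Topology

/-! It suffices to exclude periodic orbits for every `p` above the upper bound. With `α = 2 / (p -
1)`, the function `l = (α / 2) log (X Z)` satisfies `l' = α - X`, so `w = exp l` is an Emden–Fowler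
variable with kinetic energy `w'² = (α - X)² exp (2 l)`. Take a maximum of `l` on a nonconstant
periodic orbit and go back through one arc with `X < α` and one with `X > α`. On each arc the energy
is a function of `l`; at equal `l` the products `X Z` agree, and the difference of the two slopes
has the sign of `2αδ (X₂ - X₁) - 2α(1 + δ) X₁ (Z₁ - 1)⁺`, where `δ > 0` measures the distance to the
critical exponent. If this is positive, dissipation prevents the return to the same maximum
(`log_lt_of_arcs`).

The bad term occurs only for `Z > 1`. There `lt_barrier` confines the orbit below an explicit curve,
a downward perturbation of the line `Z = 2 - X / α`, and `barrier_gap` turns this into the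
inequality needed. The upper bound on the exponent enters there, as `δ > (k + 1) / (2k + 1)`. -/

theorem eventually_lt_right_of_hasDerivAt_pos {f : ℝ → ℝ} {f' a : ℝ} (h : HasDerivAt f f' a)
    (hf : 0 < f') : ∀ᶠ x in 𝓝[>] a, f a < f x := by
  have h1 := (hasDerivAt_iff_tendsto_slope.1 h).eventually_const_lt hf
  have h2 : ∀ᶠ x in 𝓝[>] a, 0 < slope f a x :=
    h1.filter_mono (nhdsWithin_mono _ fun x hx => ne_of_gt hx)
  filter_upwards [h2, self_mem_nhdsWithin] with x hx hxa
  have : 0 < (x - a) * slope f a x := mul_pos (sub_pos.2 hxa) hx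
  rw [← smul_eq_mul, sub_smul_slope, vsub_eq_sub] at this
  linarith

theorem eventually_gt_left_of_hasDerivAt_pos {f : ℝ → ℝ} {f' a : ℝ} (h : HasDerivAt f f' a)
    (hf : 0 < f') : ∀ᶠ x in 𝓝[<] a, f x < f a := by
  have h1 := (hasDerivAt_iff_tendsto_slope.1 h).eventually_const_lt hf
  have h2 : ∀ᶠ x in 𝓝[<] a, 0 < slope f a x :=
    h1.filter_mono (nhdsWithin_mono _ fun x hx => ne_of_lt hx)
  filter_upwards [h2, self_mem_nhdsWithin] with x hx hxa
  have : 0 < (a - x) * slope f a x := mul_pos (sub_pos.2 hxa) hx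
  have e : (x - a) * slope f a x = f x - f a := by
    rw [← smul_eq_mul, sub_smul_slope, vsub_eq_sub]
  linarith

/-- The last time in `[a, b]` at which a closed condition holds. -/
theorem exists_last_mem_Icc {S : Set ℝ} (hS : IsClosed S) {a b : ℝ} (hab : a ≤ b) (ha : a ∈ S) :
    ∃ c ∈ Icc a b, c ∈ S ∧ ∀ t ∈ Ioc c b, t ∉ S := by
  obtain ⟨c, hc, hmax⟩ := (isCompact_Icc.inter_right hS).exists_isGreatest
    (s := Icc a b ∩ S) ⟨a, left_mem_Icc.2 hab, ha⟩
  refine ⟨c, hc.1, hc.2, fun t ht htS => ?_⟩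
  exact absurd (hmax ⟨⟨hc.1.1.trans ht.1.le, ht.2⟩, htS⟩) (not_le.2 ht.1)

/-- The first time in `[a, b]` at which a closed condition holds. -/
theorem exists_first_mem_Icc {S : Set ℝ} (hS : IsClosed S) {a b : ℝ} (hab : a ≤ b) (hb : b ∈ S) :
    ∃ c ∈ Icc a b, c ∈ S ∧ ∀ t ∈ Ico a c, t ∉ S := by
  obtain ⟨c, hc, hmin⟩ := (isCompact_Icc.inter_right hS).exists_isLeast
    (s := Icc a b ∩ S) ⟨b, right_mem_Icc.2 hab, hb⟩
  refine ⟨c, hc.1, hc.2, fun t ht htS => ?_⟩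
  exact absurd (hmin ⟨⟨ht.1, ht.2.le.trans hc.1.2⟩, htS⟩) (not_le.2 ht.2)

/-! ### Comparison of functions along monotone arcs. -/

/-- A function vanishing at the left end point, increasing near it, and increasing wherever it is
nonnegative, is positive at the right end point. -/
theorem pos_right_of_deriv_pos_of_nonneg {F F' : ℝ → ℝ} {a b : ℝ} (hab : a < b)
    (hc : ContinuousOn F (Icc a b)) (hd : ∀ x ∈ Ioo a b, HasDerivAt F (F' x) x)
    (ha : F a = 0) (hpos : ∀ x ∈ Ioo a b, 0 ≤ F x → 0 < F' x)
    {c : ℝ} (hac : a < c) (hinit : ∀ x ∈ Ioo a b, x < c → 0 < F' x) : 0 < F b := by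
  by_contra! hb
  obtain ⟨d, had, hdm⟩ := exists_between (lt_min hab hac)
  have hdb : d < b := hdm.trans_le (min_le_left _ _)
  have hdc : d < c := hdm.trans_le (min_le_right _ _)
  have hmono : StrictMonoOn F (Icc a d) := by
    apply strictMonoOn_of_deriv_pos (convex_Icc a d) (hc.mono (Icc_subset_Icc_right hdb.le))
    intro x hx
    rw [interior_Icc] at hx
    have hx' : x ∈ Ioo a b := ⟨hx.1, hx.2.trans hdb⟩
    rw [(hd x hx').deriv]
    exact hinit x hx' (hx.2.trans hdc)
  have hFd : 0 < F d := by
    have := hmono (left_mem_Icc.2 had.le) (right_mem_Icc.2 had.le) had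
    rwa [ha] at this
  -- If `F b ≤ 0`, the maximum is positive and interior, so `F'` vanishes at a point where `F > 0`.
  obtain ⟨m, hm, hmax⟩ := isCompact_Icc.exists_isMaxOn ⟨a, left_mem_Icc.2 hab.le⟩ hc
  have hFm : 0 < F m := hFd.trans_le (hmax ⟨had.le, hdb.le⟩)
  have hma : m ≠ a := by rintro rfl; exact hFm.ne' ha
  have hmb : m ≠ b := by rintro rfl; exact absurd hFm (not_lt.2 hb)
  have hmI : m ∈ Ioo a b := ⟨lt_of_le_of_ne hm.1 hma.symm, lt_of_le_of_ne hm.2 hmb⟩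
  have hloc : IsLocalMax F m := hmax.isLocalMax (Icc_mem_nhds hmI.1 hmI.2)
  exact (hpos m hmI hFm.le).ne' (hloc.hasDerivAt_eq_zero (hd m hmI))

/-- A quantity `Q` carried by an arc on which `y` increases is a function of `y`. -/
theorem exists_function_of_monotone_arc {y u Q Q' : ℝ → ℝ} {a b : ℝ} (hab : a < b)
    (hy : ∀ t, HasDerivAt y (u t) t) (hu : ∀ t ∈ Ioo a b, 0 < u t)
    (hQ : ∀ t, HasDerivAt Q (Q' t) t) :
    ∃ P : ℝ → ℝ, ContinuousOn P (Icc (y a) (y b)) ∧ (∀ t ∈ Icc a b, P (y t) = Q t) ∧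
      StrictMonoOn y (Icc a b) ∧ y '' Icc a b = Icc (y a) (y b) ∧
      ∀ t ∈ Ioo a b, HasDerivAt P (Q' t / u t) (y t) := by
  have hyc : Continuous y := continuous_iff_continuousAt.2 fun t => (hy t).continuousAt
  have hQc : Continuous Q := continuous_iff_continuousAt.2 fun t => (hQ t).continuousAt
  have hmono : StrictMonoOn y (Icc a b) := by
    apply strictMonoOn_of_deriv_pos (convex_Icc a b) hyc.continuousOn
    intro x hx
    rw [interior_Icc] at hx
    rw [(hy x).deriv]
    exact hu x hx
  have himg : y '' Icc a b = Icc (y a) (y b) := by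
    apply Subset.antisymm
    · rintro _ ⟨t, ht, rfl⟩
      exact ⟨hmono.monotoneOn (left_mem_Icc.2 hab.le) ht ht.1,
        hmono.monotoneOn ht (right_mem_Icc.2 hab.le) ht.2⟩
    · exact intermediate_value_Icc hab.le hyc.continuousOn
  let g := Function.invFunOn y (Icc a b)
  have hgmem : ∀ x ∈ Icc (y a) (y b), g x ∈ Icc a b := fun x hx =>
    Function.invFunOn_mem (by rw [← himg] at hx; exact hx)
  have hyg : ∀ x ∈ Icc (y a) (y b), y (g x) = x := fun x hx =>
    Function.invFunOn_eq (by rw [← himg] at hx; exact hx)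
  have hgy : ∀ t ∈ Icc a b, g (y t) = t := fun t ht =>
    hmono.injOn.leftInvOn_invFunOn ht
  have hgc : ContinuousOn g (Icc (y a) (y b)) := by
    rw [continuousOn_iff_isClosed]
    intro C hC
    -- Preimages under the inverse are images under `y`, and images of compact sets are closed.
    refine ⟨y '' (C ∩ Icc a b), ((isCompact_Icc.inter_left hC).image hyc).isClosed, ?_⟩
    ext x
    constructor
    · rintro ⟨hxC, hx⟩
      exact ⟨⟨g x, ⟨hxC, hgmem x hx⟩, hyg x hx⟩, hx⟩
    · rintro ⟨⟨t, ⟨htC, ht⟩, rfl⟩, hx⟩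
      refine ⟨?_, hx⟩
      change g (y t) ∈ C
      rwa [hgy t ht]
  refine ⟨fun x => Q (g x), hQc.comp_continuousOn hgc, fun t ht => by simp only [hgy t ht],
    hmono, himg, fun t ht => ?_⟩
  have htI : t ∈ Icc a b := Ioo_subset_Icc_self ht
  have hyt : y t ∈ Ioo (y a) (y b) :=
    ⟨hmono (left_mem_Icc.2 hab.le) htI ht.1, hmono htI (right_mem_Icc.2 hab.le) ht.2⟩
  have hnhds : Icc (y a) (y b) ∈ 𝓝 (y t) := Icc_mem_nhds hyt.1 hyt.2
  have hg' : HasDerivAt g (u t)⁻¹ (y t) := by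
    apply HasDerivAt.of_local_left_inverse (hgc.continuousAt hnhds) _ (hu t ht).ne'
    · filter_upwards [hnhds] with x hx using hyg x hx
    · rw [hgy t htI]; exact hy t
  have hQ' : HasDerivAt Q (Q' t) (g (y t)) := by rw [hgy t htI]; exact hQ t
  have := hQ'.comp (y t) hg'
  rwa [← div_eq_mul_inv] at this

/-! ### The rescaled system. -/

/-- Solutions in the open first quadrant of the system with `Z` measured in units of `Λ`, the two
formulas being merged by means of the positive part of `Z - 1`; here `k = Ñ₋ - 2`. -/
structure IsScaledOrbit (k p : ℝ) (X Z : ℝ → ℝ) : Prop where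
  posX : ∀ t, 0 < X t
  posZ : ∀ t, 0 < Z t
  derivX : ∀ t, HasDerivAt X (X t * (X t - k + (k + 1) * Z t - k * max (Z t - 1) 0)) t
  derivZ : ∀ t, HasDerivAt Z
    (Z t * (k + 2 - p * X t - (k + 1) * Z t + k * max (Z t - 1) 0)) t

namespace IsScaledOrbit

variable {k p : ℝ} {X Z : ℝ → ℝ}

theorem continuousX (h : IsScaledOrbit k p X Z) : Continuous X :=
  continuous_iff_continuousAt.2 fun t => (h.derivX t).continuousAt

theorem continuousZ (h : IsScaledOrbit k p X Z) : Continuous Z :=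
  continuous_iff_continuousAt.2 fun t => (h.derivZ t).continuousAt

theorem derivX_of_one_le (h : IsScaledOrbit k p X Z) {t : ℝ} (ht : 1 ≤ Z t) :
    HasDerivAt X (X t * (X t + Z t)) t := by
  have := h.derivX t
  rw [max_eq_left (by linarith)] at this
  convert this using 1; ring

theorem derivZ_of_one_le (h : IsScaledOrbit k p X Z) {t : ℝ} (ht : 1 ≤ Z t) :
    HasDerivAt Z (Z t * (2 - p * X t - Z t)) t := by
  have := h.derivZ t
  rw [max_eq_left (by linarith)] at this
  convert this using 1; ring

theorem derivX_of_le_one (h : IsScaledOrbit k p X Z) {t : ℝ} (ht : Z t ≤ 1) :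
    HasDerivAt X (X t * (X t - k + (k + 1) * Z t)) t := by
  have := h.derivX t
  rw [max_eq_right (by linarith)] at this
  convert this using 1; ring

theorem derivZ_of_le_one (h : IsScaledOrbit k p X Z) {t : ℝ} (ht : Z t ≤ 1) :
    HasDerivAt Z (Z t * (k + 2 - p * X t - (k + 1) * Z t)) t := by
  have := h.derivZ t
  rw [max_eq_right (by linarith)] at this
  convert this using 1; ring

/-- On a periodic orbit the second component does not stay above the switching line. -/
theorem exists_le_one_of_periodic (h : IsScaledOrbit k p X Z) {T : ℝ} (hT : 0 < T)
    (hX : Function.Periodic X T) (s : ℝ) : ∃ t, Z t ≤ 1 ∧ s ≤ t := by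
  by_contra! hcon
  have hmono : StrictMonoOn X (Icc (s + 1) (s + 1 + T)) := by
    apply strictMonoOn_of_deriv_pos (convex_Icc _ _) h.continuousX.continuousOn
    intro x hx
    rw [interior_Icc] at hx
    have h1 : 1 < Z x := by
      by_contra! hle
      have := hcon x hle
      linarith [hx.1]
    rw [(h.derivX_of_one_le h1.le).deriv]
    exact mul_pos (h.posX x) (add_pos (h.posX x) (h.posZ x))
  have := hmono (left_mem_Icc.2 (by linarith)) (right_mem_Icc.2 (by linarith))
    (show s + 1 < s + 1 + T by linarith)
  rw [hX (s + 1)] at this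
  exact lt_irrefl _ this

end IsScaledOrbit

/-! ### The barrier above the switching line. -/

/-- The barrier curve `Z = barrier κ (X / α)` in the region above the switching line. -/
def barrier (κ ξ : ℝ) : ℝ := 2 - ξ - κ * (3 * ξ - 2 * ξ ^ 2)

/-- The flow above the switching line crosses the barrier downwards. -/
theorem barrier_crossing {α κ ξ : ℝ} (hα : 0 < α) (hκ : 6 * κ * (1 + α) = α) (h0 : 0 < ξ)
    (h1 : ξ < 1) :
    0 < (-1 - κ * (3 - 4 * ξ)) * (ξ * (α * ξ + barrier κ ξ)) -
      barrier κ ξ * (2 - (α + 2) * ξ - barrier κ ξ) := by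
  have hκ0 : 0 < κ := by
    by_contra! hle
    nlinarith
  have e : (-1 - κ * (3 - 4 * ξ)) * (ξ * (α * ξ + barrier κ ξ)) -
      barrier κ ξ * (2 - (α + 2) * ξ - barrier κ ξ) =
      2 * ((1 - ξ) * ξ) * (α - 3 * κ * (2 + (α - 1) * ξ - κ * (ξ * (3 - 2 * ξ)))) := by
    unfold barrier; ring
  rw [e]
  have h3 : 0 < (1 - ξ) * ξ := mul_pos (by linarith) h0
  have h4 : 0 < κ * (ξ * (3 - 2 * ξ)) := mul_pos hκ0 (mul_pos h0 (by linarith))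
  -- For `κ = 0` the last factor is `α`; the normalisation of `κ` is what keeps it positive, through
  -- this crude bound.
  have h5 : 2 + (α - 1) * ξ - κ * (ξ * (3 - 2 * ξ)) < 2 * (1 + α) := by nlinarith
  have h6 := mul_lt_mul_of_pos_left h5 (show 0 < 3 * κ by linarith)
  have h7 : 3 * κ * (2 * (1 + α)) = α := by linarith
  have : 0 < α - 3 * κ * (2 + (α - 1) * ξ - κ * (ξ * (3 - 2 * ξ))) := by linarith
  positivity

/-- An orbit can enter `Z > 1` only where `Ż ≥ 0` on `Z = 1`, that is `p X ≤ 1`, which for `ξ = X /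
α` reads `(α + 2) ξ ≤ 1`. -/
theorem barrier_entry {α κ ξ : ℝ} (hα : 0 < α) (hκ : 6 * κ * (1 + α) = α) (h0 : 0 < ξ)
    (h1 : (α + 2) * ξ ≤ 1) : 1 < barrier κ ξ := by
  have hκ0 : 0 < κ := by
    by_contra! hle
    nlinarith
  have hκ1 : 6 * κ < 1 := by nlinarith
  have hξ : ξ < 1 / 2 := by nlinarith
  unfold barrier
  nlinarith [mul_pos hκ0 h0, mul_pos hκ0 (mul_pos h0 h0)]

/-- A periodic orbit stays below the barrier while it is above the switching line. -/
theorem IsScaledOrbit.lt_barrier {k p α κ : ℝ} {X Z : ℝ → ℝ} (h : IsScaledOrbit k p X Z)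
    (hα : 0 < α) (hp : p * α = α + 2) (hκ : 6 * κ * (1 + α) = α) {T : ℝ} (hT : 0 < T)
    (hX : Function.Periodic X T) (hZ : Function.Periodic Z T) {t : ℝ} (ht : 1 < Z t) :
    X t < α ∧ Z t < barrier κ (X t / α) := by
  have hκ0 : 0 < κ := by
    by_contra! hle
    nlinarith
  obtain ⟨s, hs, hst⟩ : ∃ s, Z s ≤ 1 ∧ s ≤ t := by
    obtain ⟨s, hs, -⟩ := h.exists_le_one_of_periodic hT hX t
    obtain ⟨n, hn⟩ := exists_nat_gt ((s - t) / T)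
    refine ⟨s - n * T, by rw [hZ.sub_nat_mul_eq]; exact hs, ?_⟩
    rw [div_lt_iff₀ hT] at hn
    linarith
  obtain ⟨t₁, ht₁, hZ1, hlast⟩ := exists_last_mem_Icc
    (isClosed_le h.continuousZ continuous_const : IsClosed {t | Z t ≤ 1}) hst hs
  have ht₁t : t₁ < t := lt_of_le_of_ne ht₁.2 (by rintro rfl; exact absurd ht (not_lt.2 hZ1))
  have habove : ∀ r ∈ Ioc t₁ t, 1 < Z r := fun r hr => not_le.1 (hlast r hr)
  have hev : ∀ᶠ r in 𝓝[>] t₁, 1 < Z r := by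
    filter_upwards [Ioc_mem_nhdsGT ht₁t] with r hr using habove r hr
  have hZ1' : Z t₁ = 1 := by
    refine le_antisymm hZ1 ?_
    exact ge_of_tendsto ((h.continuousZ.tendsto t₁).mono_left nhdsWithin_le_nhds)
      (hev.mono fun r hr => hr.le)
  have hentry : p * X t₁ ≤ 1 := by
    by_contra! hlt
    have hd := (h.derivZ_of_one_le hZ1'.ge).neg
    rw [hZ1'] at hd
    have h1 := eventually_lt_right_of_hasDerivAt_pos hd (by linarith)
    obtain ⟨r, hr, hr'⟩ := (h1.and hev).exists
    simp only [Pi.neg_apply, hZ1'] at hr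
    linarith
  have hpα : ∀ r, p * X r = (α + 2) * (X r / α) := fun r => by
    rw [← hp]; field_simp
  have hξ0 : ∀ r, 0 < X r / α := fun r => div_pos (h.posX r) hα
  set G : ℝ → ℝ := fun r => barrier κ (X r / α) - Z r with hG
  have hGc : Continuous G := by
    have hXc := h.continuousX
    have hZc := h.continuousZ
    simp only [hG, barrier]
    fun_prop
  have hGt₁ : 0 < G t₁ := by
    have := barrier_entry hα hκ (hξ0 t₁) (by rw [← hpα]; exact hentry)
    simp only [hG, hZ1']; linarith
  have hXt₁ : X t₁ < α := by
    have h1 := hpα t₁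
    have h2 : (α + 2) * (X t₁ / α) ≤ 1 := by rw [← h1]; exact hentry
    have h3 : X t₁ / α < 1 := by nlinarith [hξ0 t₁]
    rwa [div_lt_one hα] at h3
  by_contra hcon
  have hbad : t ∈ {r | G r ≤ 0} ∪ {r | α ≤ X r} := by
    by_contra hnot
    simp only [mem_union, mem_ofPred_eq, not_or, not_le] at hnot
    exact hcon ⟨hnot.2, by simpa only [hG, sub_pos] using hnot.1⟩
  obtain ⟨t₂, ht₂, hbad₂, hfirst⟩ := exists_first_mem_Icc
    ((isClosed_le hGc continuous_const).union (isClosed_le continuous_const h.continuousX))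
    ht₁t.le hbad
  have ht₁₂ : t₁ < t₂ := by
    refine lt_of_le_of_ne ht₂.1 ?_
    rintro rfl
    rcases hbad₂ with hb | hb
    · exact absurd hGt₁ (not_lt.2 hb)
    · exact absurd hXt₁ (not_lt.2 hb)
  have hgood : ∀ᶠ r in 𝓝[<] t₂, 0 < G r ∧ X r < α := by
    filter_upwards [Ico_mem_nhdsLT ht₁₂] with r hr
    have := hfirst r hr
    simpa only [mem_union, mem_ofPred_eq, not_or, not_le] using this
  have hG0 : 0 ≤ G t₂ := ge_of_tendsto ((hGc.tendsto t₂).mono_left nhdsWithin_le_nhds)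
      (hgood.mono fun r hr => hr.1.le)
  have hXα : X t₂ ≤ α := le_of_tendsto ((h.continuousX.tendsto t₂).mono_left nhdsWithin_le_nhds)
      (hgood.mono fun r hr => hr.2.le)
  have hZt₂ : 1 < Z t₂ := habove t₂ ⟨ht₁₂, ht₂.2⟩
  -- At `X = α` the barrier has height `1 - κ < 1`, so a first exit with `Z > 1` must be through the
  -- barrier itself.
  have hXlt : X t₂ < α := by
    refine lt_of_le_of_ne hXα fun he => ?_
    simp only [hG, he, div_self hα.ne', barrier] at hG0
    linarith
  have hGle : G t₂ ≤ 0 := by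
    rcases hbad₂ with hb | hb
    · exact hb
    · exact absurd hXlt (not_lt.2 hb)
  have hZeq : Z t₂ = barrier κ (X t₂ / α) := by
    have : G t₂ = 0 := le_antisymm hGle hG0
    simp only [hG] at this
    linarith
  have hdX := h.derivX_of_one_le hZt₂.le
  have hdZ := h.derivZ_of_one_le hZt₂.le
  have hdξ : HasDerivAt (fun r => X r / α)
      (X t₂ / α * (α * (X t₂ / α) + Z t₂)) t₂ := by
    have e : X t₂ * (X t₂ + Z t₂) / α = X t₂ / α * (α * (X t₂ / α) + Z t₂) := by
      rw [mul_div_cancel₀ _ hα.ne']; ring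
    rw [← e]
    exact hdX.div_const α
  have hdG : HasDerivAt G ((-1 - κ * (3 - 4 * (X t₂ / α))) *
      (X t₂ / α * (α * (X t₂ / α) + Z t₂)) - Z t₂ * (2 - (α + 2) * (X t₂ / α) - Z t₂)) t₂ := by
    have h1 := (((hdξ.const_sub 2).sub (((hdξ.const_mul 3).sub
      ((hdξ.pow 2).const_mul 2)).const_mul κ)).sub hdZ)
    rw [hpα] at h1
    exact h1.congr_deriv (by norm_num; ring)
  have hpos := barrier_crossing hα hκ (hξ0 t₂) ((div_lt_one hα).2 hXlt)
  rw [← hZeq] at hpos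
  -- `G` vanishes at `t₂` with positive derivative, hence is negative just before, against the
  -- choice of `t₂` as first exit.
  obtain ⟨r, hr1, hr2⟩ := ((eventually_gt_left_of_hasDerivAt_pos hdG hpos).and hgood).exists
  linarith [hr2.1]

/-- The consequence of the barrier which the comparison of arcs needs. -/
theorem barrier_gap {α κ δ ξ Z : ℝ} (hα : 0 < α) (hκ : 6 * κ * (1 + α) = α) (hδ : 0 < δ)
    (hαδ : 2 * α * (1 + δ) + 1 < δ * (4 * α * (1 + δ) + 1)) (h0 : 0 < ξ) (h1 : ξ < 1)
    (hZ : Z < barrier κ ξ) : (1 - δ) * (1 - ξ) < (1 + δ) * (1 - ξ * Z) := by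
  have hκ0 : 0 < κ := by
    by_contra! hle
    nlinarith
  have hκ1 : 6 * κ < 1 := by nlinarith
  -- The left side is exactly `1 - ξ * barrier κ ξ`.
  have hq : (1 - ξ) ^ 2 + κ * (ξ ^ 2 * (3 - 2 * ξ)) < 1 - ξ * Z := by
    have := mul_lt_mul_of_pos_left hZ h0
    unfold barrier at this
    nlinarith
  have h2 : 0 < κ * (ξ ^ 2 * (3 - 2 * ξ)) := by
    have : 0 < 3 - 2 * ξ := by linarith
    positivity
  obtain ⟨e, rfl⟩ : ∃ e, ξ = 1 - e := ⟨1 - ξ, by ring⟩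
  have he0 : 0 < e := by linarith
  have he1 : e < 1 := by linarith
  rcases le_or_gt 1 δ with h3 | h3
  · have : (1 - δ) * (1 - (1 - e)) ≤ 0 := by nlinarith
    have h4 : 0 < 1 - (1 - e) * Z := by nlinarith
    have : 0 < (1 + δ) * (1 - (1 - e) * Z) := by positivity
    linarith
  · have hd : 0 < 1 - δ := by linarith
    suffices hs : (1 - δ) * e ≤ (1 + δ) * (e ^ 2 + κ * (1 - 3 * e ^ 2)) by
      have h5 : e ^ 2 + κ * (1 - 3 * e ^ 2) ≤ (1 - (1 - e)) ^ 2 +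
          κ * ((1 - e) ^ 2 * (3 - 2 * (1 - e))) := by
        have : 0 < κ * e ^ 3 := by positivity
        nlinarith
      have h6 := lt_of_le_of_lt h5 hq
      have := mul_lt_mul_of_pos_left h6 (show 0 < 1 + δ by linarith)
      have h7 : 1 - (1 - e) = e := by ring
      rw [h7]
      linarith
    -- the quadratic in `e` has nonpositive discriminant
    have hhalf : 1 < 2 * δ := by
      by_contra! hle
      nlinarith [mul_pos hα (show 0 < 1 + δ by linarith)]
    have hκδ : (1 - δ) ^ 2 ≤ 2 * (1 + δ) ^ 2 * κ := by
      -- A lower bound for `α` in terms of `δ`. Eliminating `α` by it leaves the one-variable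
      -- polynomial inequality `e3`.
      have e1 : 1 - δ < 2 * α * (1 + δ) * (2 * δ - 1) := by linarith
      have hB : 0 < (1 + δ) ^ 2 - 3 * (1 - δ) ^ 2 := by nlinarith
      have hc : 0 < 2 * (1 + δ) * (2 * δ - 1) :=
        mul_pos (by linarith) (by linarith)
      have e2 := mul_lt_mul_of_pos_right e1 hB
      have e3 : 6 * (1 - δ) * (1 + δ) * (2 * δ - 1) ≤ (1 + δ) ^ 2 - 3 * (1 - δ) ^ 2 := by
        have : 0 ≤ δ * (δ - 5 / 8) ^ 2 := mul_nonneg hδ.le (sq_nonneg _)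
        nlinarith [sq_nonneg (δ - 5 / 8)]
      have e4 := mul_le_mul_of_nonneg_left e3 hd.le
      have e5 : 3 * (1 - δ) ^ 2 ≤ α * ((1 + δ) ^ 2 - 3 * (1 - δ) ^ 2) := by
        refine le_of_mul_le_mul_left ?_ hc
        linarith
      have e6 : (1 + α) * (1 - δ) ^ 2 ≤ (1 + α) * (2 * (1 + δ) ^ 2 * κ) := by
        have e7 : (1 + δ) ^ 2 * (6 * κ * (1 + α)) = (1 + δ) ^ 2 * α := by rw [hκ]
        linarith
      exact le_of_mul_le_mul_left e6 (by linarith)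
    have h8 : e ^ 2 / 2 + κ ≤ e ^ 2 + κ * (1 - 3 * e ^ 2) := by
      have : 0 < e ^ 2 := by positivity
      nlinarith
    have h9 : (1 - δ) * e ≤ (1 + δ) * (e ^ 2 / 2 + κ) := by
      have : 0 ≤ ((1 + δ) * e - (1 - δ)) ^ 2 := sq_nonneg _
      have h10 : (1 + δ) * ((1 - δ) * e) ≤ (1 + δ) * ((1 + δ) * (e ^ 2 / 2 + κ)) := by nlinarith
      exact le_of_mul_le_mul_left h10 (by linarith)
    exact h9.trans (mul_le_mul_of_nonneg_left h8 (by linarith))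

/-! ### Energy comparison on consecutive arcs. -/

/-- A periodic function which vanishes at `c` and is positive just before `c` has a last zero
before `c`. -/
theorem Function.Periodic.exists_previous_zero {f : ℝ → ℝ} {T c : ℝ} (hT : 0 < T)
    (hper : Function.Periodic f T) (hf : Continuous f) (hc : f c = 0)
    (hleft : ∀ᶠ t in 𝓝[<] c, 0 < f t) :
    ∃ a < c, f a = 0 ∧ ∀ t ∈ Ioo a c, 0 < f t := by
  obtain ⟨r, hr, hrc⟩ := mem_nhdsLT_iff_exists_Ioo_subset.1 hleft
  obtain ⟨d, hd, hdc⟩ := exists_between (max_lt hr (show c - T < c by linarith))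
  have hrd : r < d := (le_max_left _ _).trans_lt hd
  have hTd : c - T < d := (le_max_right _ _).trans_lt hd
  obtain ⟨a, ha, haS, hlast⟩ := exists_last_mem_Icc
    (isClosed_le hf continuous_const : IsClosed {t | f t ≤ 0}) hTd.le
    (show f (c - T) ≤ 0 by rw [hper.sub_eq, hc])
  have hfd : 0 < f d := hrc ⟨hrd, hdc⟩
  have had : a < d := lt_of_le_of_ne ha.2 (by rintro rfl; exact absurd hfd (not_lt.2 haS))
  have hpos : ∀ t ∈ Ioo a c, 0 < f t := by
    intro t ht
    rcases le_or_gt t d with h | h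
    · exact not_le.1 (hlast t ⟨ht.1, h⟩)
    · exact hrc ⟨hrd.trans h, ht.2⟩
  refine ⟨a, had.trans hdc, le_antisymm haS ?_, hpos⟩
  refine ge_of_tendsto ((hf.tendsto a).mono_left (nhdsWithin_le_nhds (s := Ioi a))) ?_
  filter_upwards [Ioo_mem_nhdsGT (had.trans hdc)] with t ht using (hpos t ht).le

namespace IsScaledOrbit

variable {k p α δ : ℝ} {X Z : ℝ → ℝ}

/-- The logarithm of the Emden–Fowler variable, up to an additive constant. -/
theorem hasDerivAt_log (h : IsScaledOrbit k p X Z) (hp : p * α = α + 2) (t : ℝ) :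
    HasDerivAt (fun t => α / 2 * Real.log (X t * Z t)) (α - X t) t := by
  have hX := (h.posX t).ne'
  have hZ := (h.posZ t).ne'
  have h1 := (((h.derivX t).mul (h.derivZ t)).log (mul_ne_zero hX hZ)).const_mul (α / 2)
  refine h1.congr_deriv ?_
  have e : (X t * (X t - k + (k + 1) * Z t - k * max (Z t - 1) 0) * Z t +
      X t * (Z t * (k + 2 - p * X t - (k + 1) * Z t + k * max (Z t - 1) 0))) /
      (X t * Z t) = 2 - (p - 1) * X t := by
    rw [div_eq_iff (mul_ne_zero hX hZ)]; ring
  simp only [Pi.mul_apply]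
  rw [e]
  linear_combination (-X t / 2) * hp

/-- An orbit through the equilibrium is constant. -/
theorem eq_const_of_equilibrium (h : IsScaledOrbit k p X Z) (hα : 0 < α)
    (hp : p * α = α + 2) {t₀ : ℝ} (hX₀ : X t₀ = α)
    (hZ₀ : X t₀ - k + (k + 1) * Z t₀ - k * max (Z t₀ - 1) 0 = 0) :
    ∀ t, X t = α ∧ Z t = Z t₀ := by
  -- Above the switching line `Ẋ > 0`, so the equilibrium lies strictly below it, where the field is
  -- polynomial and local uniqueness applies.
  have hlt : Z t₀ < 1 := by
    by_contra! hge
    rw [max_eq_left (by linarith)] at hZ₀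
    linarith [h.posX t₀, h.posZ t₀]
  rw [max_eq_right (by linarith), hX₀] at hZ₀
  let v : ℝ × ℝ → ℝ × ℝ := fun q =>
    (q.1 * (q.1 - k + (k + 1) * q.2), q.2 * (k + 2 - p * q.1 - (k + 1) * q.2))
  have hv : ContDiff ℝ 1 v := by
    simp only [v]
    fun_prop
  have hXZ : Continuous fun t => (X t, Z t) := h.continuousX.prodMk h.continuousZ
  have hclosed : IsClosed {t | (X t, Z t) = (α, Z t₀)} := isClosed_eq hXZ continuous_const
  have hopen : IsOpen {t | (X t, Z t) = (α, Z t₀)} := by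
    rw [isOpen_iff_mem_nhds]
    intro t ht
    obtain ⟨K, s, hs, hK⟩ := (hv.contDiffAt (x := (α, Z t₀))).exists_lipschitzOnWith
    refine ODE_solution_unique_of_eventually (v := fun _ => v) (s := fun _ => s) (K := K)
      (f := fun t => (X t, Z t)) (g := fun _ => (α, Z t₀)) (Eventually.of_forall fun _ => hK)
      ?_ ?_ ht
    · have h1 : ∀ᶠ r in 𝓝 t, (X r, Z r) ∈ s := by
        apply hXZ.continuousAt
        change s ∈ 𝓝 (X t, Z t)
        rw [show (X t, Z t) = (α, Z t₀) from ht]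
        exact hs
      have h2 : ∀ᶠ r in 𝓝 t, Z r < 1 := by
        apply h.continuousZ.continuousAt.eventually_lt_const
        have e : Z t = Z t₀ := (Prod.ext_iff.1 (show (X t, Z t) = (α, Z t₀) from ht)).2
        rwa [e]
      filter_upwards [h1, h2] with r hr1 hr2
      exact ⟨(h.derivX_of_le_one hr2.le).prodMk (h.derivZ_of_le_one hr2.le), hr1⟩
    · have hv0 : v (α, Z t₀) = 0 := by
        simp only [v]
        rw [show α - k + (k + 1) * Z t₀ = 0 by linarith, show k + 2 - p * α - (k + 1) * Z t₀ = 0 by linarith]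
        simp
      refine Eventually.of_forall fun r => ⟨?_, mem_of_mem_nhds hs⟩
      change HasDerivAt (fun _ : ℝ => (α, Z t₀)) (v (α, Z t₀)) r
      rw [hv0]
      exact hasDerivAt_const r _
  have huniv := IsClopen.eq_univ ⟨hclosed, hopen⟩ ⟨t₀, by simp [hX₀]⟩
  intro t
  have ht : t ∈ {t | (X t, Z t) = (α, Z t₀)} := by rw [huniv]; trivial
  exact Prod.ext_iff.1 ht

/-- Two consecutive arcs, first with `X > α` and then with `X < α`: the latter ends strictly
below the starting level of the former. -/
theorem log_lt_of_arcs (h : IsScaledOrbit k p X Z) (hα : 0 < α) (hδ : 0 < δ)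
    (hk : k = 2 * α * (1 + δ)) (hp : p * α = α + 2)
    (hgap : ∀ t, 1 < Z t → X t < α ∧ (1 - δ) * (α - X t) < (1 + δ) * (α - X t * Z t))
    {t₀ t₁ t₂ : ℝ} (h01 : t₀ < t₁) (h12 : t₁ < t₂)
    (hX0 : X t₀ = α) (hX1 : X t₁ = α)
    (hlow : ∀ t ∈ Ioo t₀ t₁, α < X t) (hup : ∀ t ∈ Ioo t₁ t₂, X t < α) :
    α / 2 * Real.log (X t₂ * Z t₂) < α / 2 * Real.log (X t₀ * Z t₀) := by
  set l : ℝ → ℝ := fun t => α / 2 * Real.log (X t * Z t) with hl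
  change l t₂ < l t₀
  by_contra! hle
  have hld : ∀ t, HasDerivAt l (α - X t) t := h.hasDerivAt_log hp
  -- `Q` is the kinetic energy `w'²` of `w = exp l`, and `R` is its derivative with respect to `l`.
  let Q : ℝ → ℝ := fun t => (α - X t) ^ 2 * Real.exp (2 * l t)
  let R : ℝ → ℝ := fun t => 2 * Real.exp (2 * l t) *
    ((α - X t) ^ 2 - X t * (X t - k + (k + 1) * Z t - k * max (Z t - 1) 0))
  have hQd : ∀ t, HasDerivAt Q (R t * (α - X t)) t := by
    intro t
    have h1 := (((h.derivX t).const_sub α).pow 2).mul ((hld t).const_mul 2).exp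
    refine h1.congr_deriv ?_
    simp only [R, Pi.pow_apply]
    push_cast
    ring
  obtain ⟨P₁, hP₁c, hP₁, hmono₁, himg₁, hP₁d⟩ := exists_function_of_monotone_arc h12 hld
    (fun t ht => sub_pos.2 (hup t ht)) hQd
  -- Where `X > α`, `l` decreases, so this arc is traversed backwards in time.
  obtain ⟨P₂, hP₂c, hP₂, hmono₂, himg₂, hP₂d⟩ := exists_function_of_monotone_arc
    (y := fun s => l (-s)) (u := fun s => -(α - X (-s))) (Q := fun s => Q (-s))
    (Q' := fun s => -(R (-s) * (α - X (-s)))) (neg_lt_neg h01)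
    (fun s => ((hld (-s)).comp s (hasDerivAt_neg s)).congr_deriv (by ring))
    (fun s hs => by
      have := hlow (-s) ⟨by linarith [hs.2], by linarith [hs.1]⟩
      linarith)
    (fun s => ((hQd (-s)).comp s (hasDerivAt_neg s)).congr_deriv (by ring))
  simp only [neg_neg] at hP₂c himg₂
  have hlt : l t₁ < l t₀ := by
    have := hmono₂ (left_mem_Icc.2 (neg_lt_neg h01).le) (right_mem_Icc.2 (neg_lt_neg h01).le)
      (neg_lt_neg h01)
    simpa only [neg_neg] using this
  -- For `Z ≥ 1` the component `X` increases and could not drop below `α` after `t₁`. Hence the bad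
  -- term is absent near `t₁`, which starts the comparison.
  have hZ1 : Z t₁ < 1 := by
    by_contra! hge
    have hd := h.derivX_of_one_le hge
    have h1 := eventually_lt_right_of_hasDerivAt_pos hd
      (mul_pos (h.posX _) (add_pos (h.posX _) (h.posZ _)))
    obtain ⟨r, hr, hr'⟩ := (h1.and (Ioo_mem_nhdsGT h12)).exists
    rw [hX1] at hr
    exact absurd hr (not_lt.2 (hup r hr').le)
  obtain ⟨d, hd12, hdZ⟩ : ∃ d ∈ Ioo t₁ t₂, ∀ t ∈ Ioo t₁ d, Z t < 1 := by
    have h1 : ∀ᶠ t in 𝓝[>] t₁, Z t < 1 :=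
      (h.continuousZ.continuousAt.eventually_lt_const hZ1).filter_mono nhdsWithin_le_nhds
    obtain ⟨e, he, hes⟩ := (mem_nhdsGT_iff_exists_Ioo_subset).1 h1
    obtain ⟨d, hd1, hd2⟩ := exists_between (lt_min he h12)
    exact ⟨d, ⟨hd1, hd2.trans_le (min_le_right _ _)⟩, fun t ht =>
      hes ⟨ht.1, ht.2.trans (hd2.trans_le (min_le_left _ _))⟩⟩
  have key : ∀ x ∈ Ioo (l t₁) (l t₀), ∃ s₁ ∈ Ioo t₁ t₂, ∃ s₂ ∈ Ioo t₀ t₁, l s₁ = x ∧ l s₂ = x ∧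
      HasDerivAt (P₂ - P₁) (R s₂ - R s₁) x := by
    intro x hx
    obtain ⟨s₁, hs₁, hx₁⟩ : x ∈ l '' Icc t₁ t₂ := by
      rw [himg₁]; exact ⟨hx.1.le, hx.2.le.trans hle⟩
    obtain ⟨r, hr, hx₂⟩ : x ∈ (fun s => l (-s)) '' Icc (-t₁) (-t₀) := by
      rw [himg₂]; exact ⟨hx.1.le, hx.2.le⟩
    have hs₁' : s₁ ∈ Ioo t₁ t₂ := by
      refine ⟨lt_of_le_of_ne hs₁.1 ?_, lt_of_le_of_ne hs₁.2 ?_⟩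
      · rintro rfl; exact hx.1.ne hx₁
      · rintro rfl; exact (hx.2.trans_le hle).ne hx₁.symm
    have hr' : r ∈ Ioo (-t₁) (-t₀) := by
      refine ⟨lt_of_le_of_ne hr.1 ?_, lt_of_le_of_ne hr.2 ?_⟩
      · rintro rfl; simp only [neg_neg] at hx₂; exact hx.1.ne hx₂
      · rintro rfl; simp only [neg_neg] at hx₂; exact hx.2.ne hx₂.symm
    have hs₂ : -r ∈ Ioo t₀ t₁ := ⟨by linarith [hr'.2], by linarith [hr'.1]⟩
    refine ⟨s₁, hs₁', -r, hs₂, hx₁, hx₂, ?_⟩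
    have d1 := hP₁d s₁ hs₁'
    have d2 := hP₂d r hr'
    rw [mul_div_cancel_right₀ _ (sub_pos.2 (hup _ hs₁')).ne', hx₁] at d1
    rw [neg_div_neg_eq, mul_div_cancel_right₀ _ (sub_neg.2 (hlow _ hs₂)).ne] at d2
    simp only at d2 hx₂
    rw [hx₂] at d2
    exact d2.sub d1
  have key' : ∀ x ∈ Ioo (l t₁) (l t₀), ∃ s ∈ Ioo t₁ t₂, l s = x ∧
      HasDerivAt (P₂ - P₁) (deriv (P₂ - P₁) x) x ∧
      (Z s ≤ 1 ∨ 0 ≤ (P₂ - P₁) x → 0 < deriv (P₂ - P₁) x) := by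
    intro x hx
    obtain ⟨s₁, hs₁, s₂, hs₂, hx₁, hx₂, hd⟩ := key x hx
    refine ⟨s₁, hs₁, hx₁, hd.differentiableAt.hasDerivAt, fun hor => ?_⟩
    rw [hd.deriv]
    have hX₁ := hup s₁ hs₁
    have hX₂ := hlow s₂ hs₂
    have hZ₂ : Z s₂ ≤ 1 := by
      by_contra! hgt
      linarith [(hgap s₂ hgt).1]
    have hprod : X s₁ * Z s₁ = X s₂ * Z s₂ := by
      have e : α / 2 * Real.log (X s₁ * Z s₁) = α / 2 * Real.log (X s₂ * Z s₂) :=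
        hx₁.trans hx₂.symm
      exact Real.log_injOn_pos (mul_pos (h.posX _) (h.posZ _)) (mul_pos (h.posX _) (h.posZ _))
        (mul_left_cancel₀ (half_pos hα).ne' e)
    have hR : R s₂ - R s₁ = 2 * Real.exp (2 * x) * (2 * α * δ * (X s₂ - X s₁) -
        2 * α * (1 + δ) * (X s₁ * max (Z s₁ - 1) 0)) := by
      simp only [R]
      rw [hx₁, hx₂, max_eq_right (show Z s₂ - 1 ≤ 0 by linarith)]
      have e : X s₂ * Z s₂ = X s₁ * Z s₁ := hprod.symm
      rw [hk]
      linear_combination (-2 * Real.exp (2 * x) * (2 * α * (1 + δ) + 1)) * e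
    rw [hR]
    have hαδ : 0 < α * δ := mul_pos hα hδ
    refine mul_pos (by positivity) ?_
    rcases le_or_gt (Z s₁) 1 with hZ | hZ
    · rw [max_eq_right (by linarith)]
      have := mul_pos hαδ (show 0 < X s₂ - X s₁ by linarith)
      linarith
    · have hF : 0 ≤ (P₂ - P₁) x := hor.resolve_left (not_le.2 hZ)
      have e1 : P₁ x = (α - X s₁) ^ 2 * Real.exp (2 * x) := by
        rw [← hx₁]; exact hP₁ s₁ (Ioo_subset_Icc_self hs₁)
      have e2 : P₂ x = (α - X s₂) ^ 2 * Real.exp (2 * x) := by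
        have := hP₂ (-s₂) ⟨by linarith [hs₂.2], by linarith [hs₂.1]⟩
        simp only [neg_neg] at this
        rw [← hx₂]; exact this
      rw [Pi.sub_apply, e1, e2, ← sub_mul] at hF
      have hsq := nonneg_of_mul_nonneg_left hF (Real.exp_pos _)
      -- The larger energy on the arc `X > α` gives `X s₂ - X s₁ ≥ 2 (α - X s₁)`; with this, `hgap`
      -- is just what beats the bad term.
      have hW : α - X s₁ ≤ X s₂ - α := by
        by_contra! hlt
        nlinarith
      rw [max_eq_left (by linarith)]
      have hg := mul_lt_mul_of_pos_left (hgap s₁ hZ).2 hα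
      have := mul_le_mul_of_nonneg_left hW hαδ.le
      nlinarith
  have hpos := pos_right_of_deriv_pos_of_nonneg (F := P₂ - P₁) (F' := deriv (P₂ - P₁)) hlt
    (hP₂c.sub (hP₁c.mono (Icc_subset_Icc_right hle)))
    (fun x hx => by
      obtain ⟨s, -, -, hd, -⟩ := key' x hx
      exact hd)
    (by
      have e1 := hP₁ t₁ (left_mem_Icc.2 h12.le)
      have e2 := hP₂ (-t₁) (left_mem_Icc.2 (neg_lt_neg h01).le)
      simp only [neg_neg] at e2
      rw [Pi.sub_apply, e1, e2, sub_self])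
    (fun x hx hF => by
      obtain ⟨s, -, -, -, hs⟩ := key' x hx
      exact hs (Or.inr hF))
    (c := l d) (hmono₁ (left_mem_Icc.2 h12.le) (Ioo_subset_Icc_self hd12) hd12.1)
    (fun x hx hxd => by
      obtain ⟨s, hs, hsx, -, hs'⟩ := key' x hx
      refine hs' (Or.inl (hdZ s ⟨hs.1, ?_⟩).le)
      rw [← hsx] at hxd
      exact (hmono₁.lt_iff_lt (Ioo_subset_Icc_self hs) (Ioo_subset_Icc_self hd12)).1 hxd)
  -- At the level `l t₀` the energy `P₂` vanishes because `X t₀ = α`, while `P₁ ≥ 0`: this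
  -- contradicts `P₂ - P₁ > 0`.
  have e2 := hP₂ (-t₀) (right_mem_Icc.2 (neg_lt_neg h01).le)
  simp only [neg_neg] at e2
  have e2' : P₂ (l t₀) = 0 := by
    rw [e2]; simp only [Q, hX0, sub_self]; ring
  obtain ⟨s, hs, hsx⟩ : l t₀ ∈ l '' Icc t₁ t₂ := by
    rw [himg₁]; exact ⟨hlt.le, hle⟩
  have e1 : 0 ≤ P₁ (l t₀) := by
    rw [← hsx, hP₁ s hs]
    positivity
  rw [Pi.sub_apply, e2'] at hpos
  linarith

/-- Under the gap condition above the switching line all periodic solutions are constant. -/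
theorem const_of_periodic_of_gap (h : IsScaledOrbit k p X Z) (hα : 0 < α) (hδ : 0 < δ)
    (hk : k = 2 * α * (1 + δ)) (hp : p * α = α + 2)
    (hgap : ∀ t, 1 < Z t → X t < α ∧ (1 - δ) * (α - X t) < (1 + δ) * (α - X t * Z t))
    {T : ℝ} (hT : 0 < T) (hX : Function.Periodic X T) (hZ : Function.Periodic Z T) (s t : ℝ) :
    X s = X t ∧ Z s = Z t := by
  by_contra hne
  have hreg : ∀ r, X r = α → X r * (X r - k + (k + 1) * Z r - k * max (Z r - 1) 0) ≠ 0 := by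
    intro r hr h0
    have hc := h.eq_const_of_equilibrium hα hp hr
      ((mul_eq_zero.1 h0).resolve_left (h.posX r).ne')
    exact hne ⟨(hc s).1.trans (hc t).1.symm, (hc s).2.trans (hc t).2.symm⟩
  set l : ℝ → ℝ := fun t => α / 2 * Real.log (X t * Z t) with hl
  have hld : ∀ t, HasDerivAt l (α - X t) t := h.hasDerivAt_log hp
  have hlc : Continuous l := continuous_iff_continuousAt.2 fun t => (hld t).continuousAt
  have hlper : Function.Periodic l T := fun r => by simp only [hl, hX r, hZ r]
  obtain ⟨t₂, hmax⟩ : ∃ t₂, ∀ r, l r ≤ l t₂ := by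
    obtain ⟨m, -, hm⟩ := isCompact_Icc.exists_isMaxOn (nonempty_Icc.2 hT.le) hlc.continuousOn
    refine ⟨m, fun r => ?_⟩
    obtain ⟨q, hq, hrq⟩ := hlper.exists_mem_Ico₀ hT r
    rw [hrq]
    exact hm (Ico_subset_Icc_self hq)
  have hX2 : X t₂ = α := by
    have := IsLocalMax.hasDerivAt_eq_zero (Eventually.of_forall hmax) (hld t₂)
    linarith
  -- If `X` decreased through `α` at `t₂`, then `l' = α - X` would be positive afterwards, against
  -- maximality.
  have hd2 : 0 < X t₂ * (X t₂ - k + (k + 1) * Z t₂ - k * max (Z t₂ - 1) 0) := by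
    refine lt_of_le_of_ne ?_ (hreg t₂ hX2).symm
    by_contra! hneg
    have h1 := eventually_lt_right_of_hasDerivAt_pos (h.derivX t₂).neg (neg_pos.2 hneg)
    obtain ⟨e, he, hes⟩ := (mem_nhdsGT_iff_exists_Ioo_subset).1 h1
    have hmono : StrictMonoOn l (Icc t₂ e) := by
      apply strictMonoOn_of_deriv_pos (convex_Icc _ _) hlc.continuousOn
      intro x hx
      rw [interior_Icc] at hx
      have := hes hx
      simp only [mem_ofPred_eq, Pi.neg_apply, hX2] at this
      rw [(hld x).deriv]
      linarith
    have := hmono (left_mem_Icc.2 (le_of_lt he)) (right_mem_Icc.2 (le_of_lt he)) he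
    exact absurd this (not_lt.2 (hmax e))
  obtain ⟨t₁, h12, hX1, hup⟩ := Function.Periodic.exists_previous_zero (f := fun r => α - X r) hT
    (fun r => by simp only [hX r]) (continuous_const.sub h.continuousX) (by simp only [hX2, sub_self])
    ((eventually_gt_left_of_hasDerivAt_pos (h.derivX t₂) hd2).mono fun r hr => by
      rw [hX2] at hr; linarith)
  have hX1' : X t₁ = α := by linarith
  have hd1 : X t₁ * (X t₁ - k + (k + 1) * Z t₁ - k * max (Z t₁ - 1) 0) < 0 := by
    refine lt_of_le_of_ne ?_ (hreg t₁ hX1')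
    by_contra! hpos
    have h1 := eventually_lt_right_of_hasDerivAt_pos (h.derivX t₁) hpos
    obtain ⟨r, hr, hr'⟩ := (h1.and (Ioo_mem_nhdsGT h12)).exists
    have := hup r hr'
    linarith
  obtain ⟨t₀, h01, hX0, hlow⟩ := Function.Periodic.exists_previous_zero (f := fun r => X r - α) hT
    (fun r => by simp only [hX r]) (h.continuousX.sub continuous_const) (by simp only [hX1', sub_self])
    ((eventually_gt_left_of_hasDerivAt_pos (h.derivX t₁).neg (neg_pos.2 hd1)).mono fun r hr => by
      simp only [Pi.neg_apply, hX1'] at hr; linarith)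
  have := h.log_lt_of_arcs hα hδ hk hp hgap h01 h12 (by linarith) hX1'
    (fun r hr => by linarith [hlow r hr]) (fun r hr => by linarith [hup r hr])
  exact absurd (hmax t₀) (not_le.2 this)

end IsScaledOrbit

/-! ### Return to the original parameters. -/

theorem not_hasPeriodicOrbit {lam Lam p : ℝ} (hlam : 0 < lam) (hLam : lam < Lam)
    (hp : (dimMinus lam Lam 2 + 2) / (dimMinus lam Lam 2 - 2) +
        4 / (dimMinus lam Lam 2 - 2 + lam / Lam * (dimMinus lam Lam 2 - 2) ^ 2) < p) :
    ¬ HasPeriodicOrbit lam Lam p := by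
  rintro ⟨X, Z, T, hT, hpos, hdX, hdZ, hper, s, t, hne⟩
  have hLam0 : 0 < Lam := hlam.trans hLam
  obtain ⟨k, hk⟩ : ∃ k, k = Lam / lam - 1 := ⟨_, rfl⟩
  have hk0 : 0 < k := by
    have := (one_lt_div hlam).2 hLam
    linarith
  have hdim : dimMinus lam Lam 2 = k + 2 := by rw [dimMinus, hk]; push_cast; ring
  have hratio : Lam = (k + 1) * lam := by rw [hk]; field_simp; ring
  have hinv : lam / Lam = 1 / (k + 1) := by
    rw [hratio]
    have := hlam.ne'
    have : k + 1 ≠ 0 := by positivity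
    field_simp
  have hbound : (dimMinus lam Lam 2 + 2) / (dimMinus lam Lam 2 - 2) +
      4 / (dimMinus lam Lam 2 - 2 + lam / Lam * (dimMinus lam Lam 2 - 2) ^ 2) =
      1 + 4 * (3 * k + 2) / (k * (2 * k + 1)) := by
    rw [hdim, hinv, show k + 2 + 2 = k + 4 by ring, show k + 2 - 2 = k by ring]
    have h1 : k + 1 / (k + 1) * k ^ 2 = k * (2 * k + 1) / (k + 1) := by field_simp; ring
    rw [h1]
    field_simp
    ring
  rw [hbound] at hp
  have hq : 0 < 4 * (3 * k + 2) / (k * (2 * k + 1)) := by positivity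
  have hp1 : 0 < p - 1 := by linarith
  have hp2 : 4 * (3 * k + 2) < (p - 1) * (k * (2 * k + 1)) := by
    rw [← div_lt_iff₀ (by positivity)]; linarith
  obtain ⟨α, hα⟩ : ∃ α, α = 2 / (p - 1) := ⟨_, rfl⟩
  have hα0 : 0 < α := by rw [hα]; positivity
  have hpα : (p - 1) * α = 2 := by rw [hα]; field_simp
  -- `δ = 0` corresponds to the critical exponent `(k + 4) / k`, and the assumed bound on `p`
  -- becomes `δ > (k + 1) / (2k + 1)`.
  obtain ⟨δ, hδ⟩ : ∃ δ, δ = k * (p - 1) / 4 - 1 := ⟨_, rfl⟩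
  have hδk : k + 1 < δ * (2 * k + 1) := by rw [hδ]; linarith
  have hδ0 : 0 < δ := by
    by_contra! hle
    nlinarith
  have hkα : k = 2 * α * (1 + δ) := by
    rw [hδ]; linear_combination (-k / 2) * hpα
  have hκ : 6 * (α / (6 * (1 + α))) * (1 + α) = α := by field_simp
  have horb : IsScaledOrbit k p X (fun t => Z t / Lam) := by
    refine ⟨fun t => (hpos t).1, fun t => div_pos (hpos t).2 hLam0, fun t => ?_, fun t => ?_⟩
    · refine (hdX t).congr_deriv ?_
      rw [fieldX, hdim]
      split_ifs with hZ
      · rw [max_eq_left (by rw [sub_nonneg, one_le_div hLam0]; exact hZ.le)]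
        ring
      · rw [max_eq_right (by rw [sub_nonpos, div_le_one hLam0]; exact not_lt.1 hZ), hratio]
        field_simp
        ring
    · refine ((hdZ t).div_const Lam).congr_deriv ?_
      rw [fieldZ, hdim]
      split_ifs with hZ
      · rw [max_eq_left (by rw [sub_nonneg, one_le_div hLam0]; exact hZ.le)]
        ring
      · rw [max_eq_right (by rw [sub_nonpos, div_le_one hLam0]; exact not_lt.1 hZ), hratio]
        field_simp
        ring
  have hXper : Function.Periodic X T := fun r => (hper r).1
  have hZper : Function.Periodic (fun t => Z t / Lam) T := fun r => by simp only [(hper r).2]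
  have hpα' : p * α = α + 2 := by linarith
  have hconst := horb.const_of_periodic_of_gap hα0 hδ0 hkα hpα' (fun r hr => by
    obtain ⟨h1, h2⟩ := horb.lt_barrier hα0 hpα' hκ hT hXper hZper hr
    refine ⟨h1, ?_⟩
    have h3 := barrier_gap hα0 hκ hδ0 (by rw [hkα] at hδk; linarith)
      (div_pos (horb.posX r) hα0) ((div_lt_one hα0).2 h1) h2
    have h4 := mul_lt_mul_of_pos_left h3 hα0
    have e : α * (X r / α) = X r := mul_div_cancel₀ _ hα0.ne'
    have e1 : α * ((1 - δ) * (1 - X r / α)) = (1 - δ) * (α - X r) := by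
      linear_combination (-(1 - δ)) * e
    have e2 : α * ((1 + δ) * (1 - X r / α * (Z r / Lam))) =
        (1 + δ) * (α - X r * (Z r / Lam)) := by
      linear_combination (-(1 + δ) * (Z r / Lam)) * e
    rwa [e1, e2] at h4) hT hXper hZper s t
  rcases hne with hX | hZ
  · exact hX hconst.1
  · exact hZ ((div_left_inj' hLam0.ne').1 hconst.2)

theorem theorem3p3 (lam Lam : ℝ) (hlam : 0 < lam) (hLam : lam < Lam) :
    (noOrbitExponents lam Lam).Nonempty ∧
    (dimMinus lam Lam 2 + 2) / (dimMinus lam Lam 2 - 2) ≤ pTildeMinus lam Lam ∧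
    pTildeMinus lam Lam ≤
      (dimMinus lam Lam 2 + 2) / (dimMinus lam Lam 2 - 2) +
        4 / (dimMinus lam Lam 2 - 2 + lam / Lam * (dimMinus lam Lam 2 - 2) ^ 2) := by
  have hmem : (dimMinus lam Lam 2 + 2) / (dimMinus lam Lam 2 - 2) +
      4 / (dimMinus lam Lam 2 - 2 + lam / Lam * (dimMinus lam Lam 2 - 2) ^ 2) ∈
      noOrbitExponents lam Lam := by
    refine ⟨?_, fun p hp => not_hasPeriodicOrbit hlam hLam hp⟩
    have h1 : 0 < dimMinus lam Lam 2 - 2 := by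
      have := (one_lt_div hlam).2 hLam
      rw [dimMinus]; push_cast; linarith
    have h2 : 0 < Lam := hlam.trans hLam
    have : 0 < 4 / (dimMinus lam Lam 2 - 2 + lam / Lam * (dimMinus lam Lam 2 - 2) ^ 2) := by
      positivity
    linarith
  have hlb : ∀ q ∈ noOrbitExponents lam Lam,
      (dimMinus lam Lam 2 + 2) / (dimMinus lam Lam 2 - 2) ≤ q := fun q hq => hq.1.le
  exact ⟨⟨_, hmem⟩, le_csInf ⟨_, hmem⟩ hlb, csInf_le ⟨_, hlb⟩ hmem⟩
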